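/- Let $G$ be a finite connected simple undirected graph (no loops, all edges of weight $1$) with $n\ge 1$ vertices $1,\dots,n$ and $m$ edges. Let $d=(d_1,\dots,d_n)^{\top}$ be its vector of degrees, let $\tau$ be the number of spanning trees of $G$, and let $\Sigma=(\sigma_{ij})$ be the $n\times n$ matrix in which, for $i\neq j$, $\sigma_{ij}$ is the number of spanning forests of $G$ consisting of exactly two trees, one containing $i$ and the other containing $j$, and $\sigma_{ii}=0$. Let $k\in\{1,\dots,n\}$ and let $w>0$ be real, and let $G(k,w)$ be the weighted graph obtained from $G$ by adding a loop of weight $w$ at vertex $k$; that is, its adjacency matrix is $A_{k,w}=A+w\,e_ke_k^{\top}$, where $A$ is the adjacency matrix of $G$ and $e_k$ is the $k$th unit vector. For a connected weighted graph with adjacency matrix $B$, Kemeny's constant is that of the transition matrix $P=\operatorname{diag}(B\mathbf 1)^{-1}B$ of its random walk, namely $$\kappa=\operatorname{trace}\big((I-P+\mathbf 1 v^{\top})^{-1}\big)-1,$$ where $v$ is any real vector with $v^{\top}\mathbf 1=1$ (the matrix $I-P+\mathbf 1 v^{\top}$ is invertible for every such $v$, and the value does not depend on $v$). Then $$\kappa(G(k,w))=\frac{d^{\top}\Sigma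 d+2w\,d^{\top}\Sigma e_k}{2\tau(2m+w)}.$$ -/

import Mathlib

open Matrix

noncomputable section

/-- The degree vector `A 1` (row sums) of a weighted graph with adjacency matrix `A`. -/
def degVec {V : Type*} [Fintype V] (A : Matrix V V ℝ) : V → ℝ := A *ᵥ 1

/-- The transition matrix `D⁻¹ A`, `D = diag (A 1)`, of the random walk on the weighted graph
with adjacency matrix `A`. -/
def transitionMatrix {V : Type*} [Fintype V] [DecidableEq V] (A : Matrix V V ℝ) :
    Matrix V V ℝ :=
  (Matrix.diagonal (degVec A))⁻¹ * A

/-- `κ` is Kemeny's constant of the stochastic matrix `P`: for every vector `v` with `vᵀ 1 = 1`,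
the matrix `I - P + 1 vᵀ` is invertible and `κ = trace ((I - P + 1 vᵀ)⁻¹) - 1`.
Such `v` exist when the state space is nonempty, so `κ` is then unique. -/
def IsKemenyConstant {V : Type*} [Fintype V] [DecidableEq V] (P : Matrix V V ℝ) (κ : ℝ) : Prop :=
  ∀ v : V → ℝ, v ⬝ᵥ 1 = 1 →
    IsUnit (1 - P + Matrix.vecMulVec 1 v) ∧
      κ = Matrix.trace (1 - P + Matrix.vecMulVec 1 v)⁻¹ - 1

/-- The adjacency matrix of the weighted graph `G(k, w)`: all edges of `G` with weight one, and
a loop of weight `w` at the vertex `k` (it adds `w` to the diagonal entry at `k`). -/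
def loopAdjMatrix {V : Type*} [DecidableEq V] (G : SimpleGraph V) [DecidableRel G.Adj]
    (k : V) (w : ℝ) : Matrix V V ℝ :=
  G.adjMatrix ℝ + Matrix.single k k w

/-- The number of spanning trees of `G`. -/
def numSpanningTrees {V : Type*} (G : SimpleGraph V) : ℕ :=
  {T : SimpleGraph V | T ≤ G ∧ T.IsTree}.ncard

/-- The number of spanning forests of `G` consisting of exactly two trees, one containing `i` and
the other containing `j`. It is zero for `i = j`. -/
def numTwoForests {V : Type*} (G : SimpleGraph V) (i j : V) : ℕ :=
  {F : SimpleGraph V | F ≤ G ∧ F.IsAcyclic ∧ Nat.card F.ConnectedComponent = 2 ∧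
    F.connectedComponentMk i ≠ F.connectedComponentMk j}.ncard

/-- The matrix `Σ` of the numbers of two-tree spanning forests separating pairs of vertices. -/
def twoForestMatrix {V : Type*} (G : SimpleGraph V) : Matrix V V ℝ :=
  Matrix.of fun i j => (numTwoForests G i j : ℝ)

/-- The vector of vertex degrees of `G`. -/
def degreeVector {V : Type*} [Fintype V] (G : SimpleGraph V) [DecidableRel G.Adj] : V → ℝ :=
  fun i => (G.degree i : ℝ)

end

/-! For fixed `j`, `k`, counting the two-tree forests that separate `j` from `k` with `i` on the
side of `j` gives a function of `i` that the Laplacian sends to `τ (e_j - e_k)`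
(`lapMatrix_mulVec_forestPotential`): potential drops along an edge become signed counts of spanning
trees through it, and each tree then contributes one unit of current along its path from `j` to `k`.
Averaging these potentials over the degrees yields a generalized inverse of `I - P`, whose trace
gives Kemeny's constant as `dᵀ Σ d / (2 τ ∑ dᵢ)` (`isKemenyConstant_of_potential`). A loop cancels
in the Laplacian, so the potentials and `Σ` remain those of `G`; only `d` becomes `d + w e_k`.
Expanding the quadratic form with `Σ` symmetric and `σ_kk = 0` finishes. -/

namespace SimpleGraph

variable {V : Type*}

/-! ### Exchanging trees and two-tree forests along an edge -/

/-- Every vertex of a connected graph stays connected to an end of a deleted edge. -/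
theorem Connected.reachable_deleteEdges_or {T : SimpleGraph V} (hT : T.Connected) (i u x : V) :
    (T.deleteEdges {s(i, u)}).Reachable i x ∨ (T.deleteEdges {s(i, u)}).Reachable u x := by
  obtain ⟨p⟩ := hT.preconnected x i
  induction p with
  | nil => exact Or.inl .rfl
  | @cons a b c hab q ih =>
    by_cases h : s(a, b) = s(c, u)
    · rcases Sym2.eq_iff.mp h with ⟨rfl, rfl⟩ | ⟨rfl, rfl⟩
      · exact Or.inl .rfl
      · exact Or.inr .rfl
    · have hba : (T.deleteEdges {s(c, u)}).Adj b a := by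
        rw [deleteEdges_adj]
        refine ⟨hab.symm, ?_⟩
        rwa [Set.mem_singleton_iff, Sym2.eq_swap]
      exact ih.imp (·.trans hba.reachable) (·.trans hba.reachable)

theorem IsAcyclic.not_reachable_deleteEdges {T : SimpleGraph V} (hT : T.IsAcyclic) {i u : V}
    (h : T.Adj i u) : ¬ (T.deleteEdges {s(i, u)}).Reachable i u :=
  isBridge_iff.mp (isAcyclic_iff_forall_adj_isBridge.mp hT h)

/-- In a tree, exactly one neighbour of `i` leads to a given other vertex `k`. -/
theorem IsTree.existsUnique_adj_reachable_deleteEdges {T : SimpleGraph V} (hT : T.IsTree) {i k : V}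
    (hik : i ≠ k) : ∃! u, T.Adj i u ∧ (T.deleteEdges {s(i, u)}).Reachable u k := by
  classical
  -- A walk through `i` would rejoin the ends of the deleted edge. Hence prefixing that edge to a
  -- path from `u` to `k` gives a path from `i`, and uniqueness of tree paths determines `u`.
  have avoid : ∀ {u : V} (h : T.Adj i u) (q : (T.deleteEdges {s(i, u)}).Walk u k),
      i ∉ q.support := fun h q hi =>
    hT.isAcyclic.not_reachable_deleteEdges h (q.takeUntil i hi).reachable.symm
  obtain ⟨p, hp, -⟩ := hT.existsUnique_path i k
  cases p with
  | nil => exact absurd rfl hik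
  | @cons _ u _ h q =>
    rw [Walk.cons_isPath_iff] at hp
    refine ⟨u, ⟨h, ?_⟩, ?_⟩
    · rw [reachable_deleteEdges_iff_exists_walk]
      exact ⟨q, fun hq => hp.2 (q.fst_mem_support_of_mem_edges hq)⟩
    · rintro u' ⟨h', ⟨r⟩⟩
      have hr := avoid h' r.toPath.1
      let r' : T.Walk u' k := r.toPath.1.mapLe (deleteEdges_le _)
      have hr' : (Walk.cons h' r').IsPath := by
        rw [Walk.cons_isPath_iff]
        refine ⟨(Walk.isPath_mapLe _).mpr r.toPath.2, ?_⟩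
        simpa [r'] using hr
      have := (hT.isAcyclic.subsingleton_path i k).elim ⟨_, hr'⟩
        ⟨_, (Walk.cons_isPath_iff h q).mpr hp⟩
      have := congrArg (fun w : T.Path i k => w.1.snd) this
      simpa using this

theorem card_connectedComponent_eq_two {T : SimpleGraph V} {i u : V}
    (hne : ¬ T.Reachable i u) (h : ∀ x, T.Reachable i x ∨ T.Reachable u x) :
    Nat.card T.ConnectedComponent = 2 := by
  rw [Nat.card_eq_two_iff]
  refine ⟨T.connectedComponentMk i, T.connectedComponentMk u,
    fun h => hne (ConnectedComponent.exact h), Set.eq_univ_of_forall fun c => ?_⟩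
  induction c using ConnectedComponent.ind with | _ x =>
  rcases h x with h | h
  · exact Or.inl (ConnectedComponent.sound h.symm)
  · exact Or.inr (ConnectedComponent.sound h.symm)

theorem reachable_or_of_card_connectedComponent_eq_two {F : SimpleGraph V}
    (hF : Nat.card F.ConnectedComponent = 2) {i u : V} (hne : ¬ F.Reachable i u) (x : V) :
    F.Reachable i x ∨ F.Reachable u x := by
  obtain ⟨y, -, hy⟩ := (Nat.card_eq_two_iff' (F.connectedComponentMk i)).mp hF
  by_cases hx : F.Reachable i x
  · exact Or.inl hx
  · have h1 := hy (F.connectedComponentMk x) fun h => hx (ConnectedComponent.exact h).symm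
    have h2 := hy (F.connectedComponentMk u) fun h => hne (ConnectedComponent.exact h).symm
    exact Or.inr (ConnectedComponent.exact (h2.trans h1.symm))

/-- Joining the two components of a two-tree forest by an edge gives a tree. -/
theorem isTree_sup_edge {F : SimpleGraph V} (hF : F.IsAcyclic)
    (hc : Nat.card F.ConnectedComponent = 2) {i u : V} (hne : ¬ F.Reachable i u) :
    (F ⊔ edge i u).IsTree := by
  refine ⟨?_, hF.sup_edge_of_not_reachable hne⟩
  have hiu : i ≠ u := fun h => hne (h ▸ .rfl)
  have hadj : (F ⊔ edge i u).Adj i u := by simp [edge_adj, hiu]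
  rw [connected_iff_exists_forall_reachable]
  refine ⟨i, fun x => ?_⟩
  rcases reachable_or_of_card_connectedComponent_eq_two hc hne x with h | h
  · exact h.mono le_sup_left
  · exact hadj.reachable.trans (h.mono le_sup_left)

theorem deleteEdges_sup_edge_cancel {F : SimpleGraph V} {i u : V} (h : ¬ F.Adj i u) :
    (F ⊔ edge i u).deleteEdges {s(i, u)} = F := by
  ext a b
  simp only [deleteEdges_adj, sup_adj, edge_adj, Set.mem_singleton_iff, Sym2.eq_iff]
  constructor
  · tauto
  · intro hab
    refine ⟨Or.inl hab, ?_⟩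
    rintro (⟨rfl, rfl⟩ | ⟨rfl, rfl⟩)
    · exact h hab
    · exact h hab.symm

theorem sup_edge_deleteEdges_cancel {T : SimpleGraph V} {i u : V} (h : T.Adj i u) :
    T.deleteEdges {s(i, u)} ⊔ edge i u = T := by
  ext a b
  simp only [deleteEdges_adj, sup_adj, edge_adj, Set.mem_singleton_iff, Sym2.eq_iff]
  constructor
  · rintro (⟨hab, -⟩ | ⟨⟨rfl, rfl⟩ | ⟨rfl, rfl⟩, -⟩)
    · exact hab
    · exact h
    · exact h.symm
  · intro hab
    have := hab.ne
    tauto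

/-! ### Forest counts as electrical potentials -/

open scoped Classical in
/-- The spanning trees of `G`. -/
noncomputable def spanningTrees [Finite V] (G : SimpleGraph V) : Finset (SimpleGraph V) :=
  (Set.toFinite {T : SimpleGraph V | T ≤ G ∧ T.IsTree}).toFinset

/-- The spanning forests of `G` with exactly two components. -/
noncomputable def twoForests [Finite V] (G : SimpleGraph V) : Finset (SimpleGraph V) :=
  (Set.toFinite {F : SimpleGraph V |
    F ≤ G ∧ F.IsAcyclic ∧ Nat.card F.ConnectedComponent = 2}).toFinset

open scoped Classical in
/-- The number of two-tree spanning forests of `G` separating `j` from `k` with `i` on the side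
of `j`. As a function of `i`, this is a multiple of the potential of a unit current flow from `j`
to `k`. -/
noncomputable def forestPotential [Finite V] (G : SimpleGraph V) (j k i : V) : ℝ :=
  ∑ F ∈ G.twoForests, if ¬ F.Reachable j k ∧ F.Reachable j i then 1 else 0

theorem numTwoForests_self (G : SimpleGraph V) (j : V) : numTwoForests G j j = 0 := by
  simp [numTwoForests]

variable [Finite V] {G : SimpleGraph V}

theorem mem_spanningTrees {T : SimpleGraph V} : T ∈ G.spanningTrees ↔ T ≤ G ∧ T.IsTree := by
  simp [spanningTrees]

theorem mem_twoForests {F : SimpleGraph V} : F ∈ G.twoForests ↔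
    F ≤ G ∧ F.IsAcyclic ∧ Nat.card F.ConnectedComponent = 2 := by
  simp [twoForests]

theorem card_spanningTrees (G : SimpleGraph V) : G.spanningTrees.card = numSpanningTrees G := by
  rw [numSpanningTrees, spanningTrees, Set.ncard_eq_toFinset_card]

open scoped Classical in
theorem numTwoForests_eq_sum (G : SimpleGraph V) (j k : V) :
    (numTwoForests G j k : ℝ) = ∑ F ∈ G.twoForests, if ¬ F.Reachable j k then 1 else 0 := by
  rw [Finset.sum_boole, numTwoForests, ← Set.ncard_coe_finset]
  congr 2
  ext F
  simp [mem_twoForests, and_assoc]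

open scoped Classical in
theorem forestPotential_self_left (G : SimpleGraph V) (j k : V) :
    G.forestPotential j k j = numTwoForests G j k := by
  rw [numTwoForests_eq_sum, forestPotential]
  exact Finset.sum_congr rfl fun F _ => if_congr (and_iff_left .rfl) rfl rfl

/-- In a forest separating `j` from `k`, every vertex lies on exactly one of the two sides. -/
theorem forestPotential_add_swap (G : SimpleGraph V) (j k i : V) :
    G.forestPotential j k i + G.forestPotential k j i = numTwoForests G j k := by
  rw [numTwoForests_eq_sum, forestPotential, forestPotential, ← Finset.sum_add_distrib]
  refine Finset.sum_congr rfl fun F hF => ?_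
  by_cases hjk : F.Reachable j k
  · simp [hjk, hjk.symm]
  · have hkj : ¬ F.Reachable k j := fun h => hjk h.symm
    have h1 := reachable_or_of_card_connectedComponent_eq_two (mem_twoForests.mp hF).2.2 hjk i
    have h2 : ¬ (F.Reachable j i ∧ F.Reachable k i) := fun h => hjk (h.1.trans h.2.symm)
    by_cases hj : F.Reachable j i <;> by_cases hk : F.Reachable k i <;>
      simp_all

open scoped Classical in
/-- The potential difference along an edge, as a sum over the spanning trees with that edge. -/
theorem forestPotential_sub_of_adj (j k : V) {i u : V} (h : G.Adj i u) :
    G.forestPotential j k i - G.forestPotential j k u =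
      ∑ T ∈ G.spanningTrees, if T.Adj i u then
        (if (T.deleteEdges {s(i, u)}).Reachable u k then (1 : ℝ) else 0) -
          (if (T.deleteEdges {s(i, u)}).Reachable u j then 1 else 0) else 0 := by
  -- Forests joining `i` to `u` cancel. In the others the two trees are those of `i` and `u`, so the
  -- sign depends only on which of `j`, `k` lie with `u`.
  have key : ∀ F ∈ G.twoForests,
      ((if ¬ F.Reachable j k ∧ F.Reachable j i then (1 : ℝ) else 0) -
        if ¬ F.Reachable j k ∧ F.Reachable j u then 1 else 0) =
      if ¬ F.Reachable i u then
        (if F.Reachable u k then (1 : ℝ) else 0) - (if F.Reachable u j then 1 else 0) else 0 := by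
    intro F hF
    by_cases hiu : F.Reachable i u
    · have : F.Reachable j i ↔ F.Reachable j u :=
        ⟨fun h => h.trans hiu, fun h => h.trans hiu.symm⟩
      simp [hiu, this]
    · have hor := reachable_or_of_card_connectedComponent_eq_two (mem_twoForests.mp hF).2.2 hiu
      have hnot : ∀ x, F.Reachable u x → ¬ F.Reachable i x :=
        fun x h1 h2 => hiu (h2.trans h1.symm)
      have hj : F.Reachable j i ↔ ¬ F.Reachable u j :=
        ⟨fun h1 h2 => hnot j h2 h1.symm, fun h1 => ((hor j).resolve_right h1).symm⟩
      have hjk : F.Reachable j k ↔ (F.Reachable u j ↔ F.Reachable u k) := by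
        constructor
        · exact fun h => ⟨fun h' => h'.trans h, fun h' => h'.trans h.symm⟩
        · intro h
          by_cases hu : F.Reachable u j
          · exact hu.symm.trans (h.mp hu)
          · exact ((hor j).resolve_right hu).symm.trans ((hor k).resolve_right (mt h.mpr hu))
      rw [hj, hjk, reachable_comm (u := j) (v := u)]
      by_cases h1 : F.Reachable u j <;> by_cases h2 : F.Reachable u k <;> simp [h1, h2, hiu]
  rw [forestPotential, forestPotential, ← Finset.sum_sub_distrib, Finset.sum_congr rfl key,
    ← Finset.sum_filter, ← Finset.sum_filter]
  refine Finset.sum_nbij' (fun F => F ⊔ edge i u) (fun T => T.deleteEdges {s(i, u)}) ?_ ?_ ?_ ?_ ?_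
  · intro F hF
    rw [Finset.mem_filter, mem_twoForests] at hF
    obtain ⟨⟨hFG, hac, hc⟩, hne⟩ := hF
    rw [Finset.mem_filter, mem_spanningTrees]
    refine ⟨⟨sup_le hFG ?_, isTree_sup_edge hac hc hne⟩, ?_⟩
    · exact (edge_le_iff G).mpr (Or.inr h)
    · simp [edge_adj, h.ne]
  · intro T hT
    rw [Finset.mem_filter, mem_spanningTrees] at hT
    obtain ⟨⟨hTG, hT⟩, hadj⟩ := hT
    have hne := hT.isAcyclic.not_reachable_deleteEdges hadj
    rw [Finset.mem_filter, mem_twoForests]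
    exact ⟨⟨(deleteEdges_le _).trans hTG, hT.isAcyclic.anti (deleteEdges_le _),
      card_connectedComponent_eq_two hne (hT.connected.reachable_deleteEdges_or i u)⟩, hne⟩
  · intro F hF
    exact deleteEdges_sup_edge_cancel fun h => (Finset.mem_filter.mp hF).2 h.reachable
  · intro T hT
    exact sup_edge_deleteEdges_cancel (Finset.mem_filter.mp hT).2
  · intro F hF
    rw [deleteEdges_sup_edge_cancel fun h => (Finset.mem_filter.mp hF).2 h.reachable]

-- The one neighbour counted is the first step of the tree path from `i` to `k`; there is none when
-- `i = k`.
open scoped Classical in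
theorem IsTree.sum_adj_reachable_deleteEdges {V : Type*} [Fintype V] [DecidableEq V]
    {T : SimpleGraph V} (hT : T.IsTree) (i k : V) :
    (∑ u, if T.Adj i u ∧ (T.deleteEdges {s(i, u)}).Reachable u k then (1 : ℝ) else 0) =
      if i = k then 0 else 1 := by
  split_ifs with hik
  · subst hik
    refine Finset.sum_eq_zero fun u _ => if_neg fun h => ?_
    exact hT.isAcyclic.not_reachable_deleteEdges h.1 h.2.symm
  · obtain ⟨u, hu, huniq⟩ := hT.existsUnique_adj_reachable_deleteEdges hik
    rw [Finset.sum_eq_single u (fun b _ hb => if_neg fun h => hb (huniq b h)) (by simp), if_pos hu]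

open scoped Classical in
/-- The Kirchhoff current law for the forest potential: it is `numSpanningTrees G` times the
potential of a unit current flow from `j` to `k`. -/
theorem lapMatrix_mulVec_forestPotential {V : Type*} [Fintype V] [DecidableEq V]
    (G : SimpleGraph V) [DecidableRel G.Adj] (j k : V) :
    G.lapMatrix ℝ *ᵥ G.forestPotential j k =
      (numSpanningTrees G : ℝ) • (Pi.single j 1 - Pi.single k 1) := by
  ext i
  have h1 : (G.lapMatrix ℝ *ᵥ G.forestPotential j k) i =
      ∑ u ∈ G.neighborFinset i, (G.forestPotential j k i - G.forestPotential j k u) := by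
    rw [lapMatrix_mulVec_apply, Finset.sum_sub_distrib, Finset.sum_const, nsmul_eq_mul,
      card_neighborFinset_eq_degree]
  rw [h1, Finset.sum_congr rfl fun u hu =>
    forestPotential_sub_of_adj j k ((mem_neighborFinset _ _ _).mp hu), Finset.sum_comm]
  trans ∑ T ∈ G.spanningTrees, (Pi.single j 1 - Pi.single k 1 : V → ℝ) i
  · refine Finset.sum_congr rfl fun T hT => ?_
    obtain ⟨hTG, hT⟩ := mem_spanningTrees.mp hT
    rw [Finset.sum_subset (Finset.subset_univ _) fun u _ hu => if_neg fun h =>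
      hu ((mem_neighborFinset _ _ _).mpr (hTG h))]
    trans (if i = k then (0 : ℝ) else 1) - if i = j then 0 else 1
    · rw [← hT.sum_adj_reachable_deleteEdges i k, ← hT.sum_adj_reachable_deleteEdges i j,
        ← Finset.sum_sub_distrib]
      refine Finset.sum_congr rfl fun u _ => ?_
      by_cases h : T.Adj i u
      · simp only [h, true_and, if_true]
        congr
      · simp [h]
    · simp only [Pi.sub_apply, Pi.single_apply]
      split_ifs <;> simp
  · rw [Finset.sum_const, nsmul_eq_mul, card_spanningTrees]
    simp

end SimpleGraph

/-! ### Kemeny's constant from potentials -/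

/-- Kemeny's constant of a random walk, from a system `f j k` of potentials of flows of strength `τ`
from `j` to `k`. -/
theorem isKemenyConstant_of_potential {V : Type*} [Fintype V] [DecidableEq V] [Nonempty V]
    {A S : Matrix V V ℝ} {f : V → V → V → ℝ} {τ : ℝ} (hA : ∀ i, 0 < degVec A i) (hτ : τ ≠ 0)
    (hf : ∀ j k, (diagonal (degVec A) - A) *ᵥ f j k = τ • (Pi.single j 1 - Pi.single k 1))
    (hS : ∀ j k, f j k j = S j k) (hsymm : ∀ j k i, f j k i + f k j i = S j k) :
    IsKemenyConstant (transitionMatrix A)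
      (degVec A ⬝ᵥ (S *ᵥ degVec A) / (2 * τ * ∑ i, degVec A i)) := by
  set d := degVec A with hd
  set s := ∑ i, d i with hs
  set L := diagonal d - A with hL
  have hs0 : s ≠ 0 := (Finset.sum_pos (fun i _ => hA i) Finset.univ_nonempty).ne'
  have hd0 : ∀ i, d i ≠ 0 := fun i => (hA i).ne'
  set q := d ⬝ᵥ (S *ᵥ d) with hq
  have hq' : q = ∑ j, ∑ k, d j * d k * S j k := by
    simp only [hq, dotProduct, mulVec, Finset.mul_sum]
    exact Finset.sum_congr rfl fun j _ => Finset.sum_congr rfl fun k _ => by ring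
  have hL1 : L *ᵥ 1 = 0 := by
    rw [hL, sub_mulVec, show A *ᵥ 1 = d from rfl]
    ext i
    simp [mulVec_diagonal]
  -- Column `j` is `d j` times the potential of a unit current entering at `j` and leaving in
  -- proportion to `d`.
  let Z : Matrix V V ℝ := of fun i j => (τ * s)⁻¹ * (∑ k, d k * f j k i) * d j
  have hLZ : ∀ i j, (L * Z) i j = (if i = j then d j else 0) - d i * d j / s := by
    intro i j
    have h1 : (L * Z) i j = (τ * s)⁻¹ * (∑ k, d k * (L *ᵥ f j k) i) * d j := by
      simp only [mul_apply, Z, of_apply, mulVec, dotProduct, Finset.mul_sum, Finset.sum_mul]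
      rw [Finset.sum_comm]
      exact Finset.sum_congr rfl fun k _ => Finset.sum_congr rfl fun u _ => by ring
    have h2 : ∑ k, d k * (L *ᵥ f j k) i = τ * ((if i = j then s else 0) - d i) := by
      simp only [hf, Pi.smul_apply, Pi.sub_apply, Pi.single_apply, smul_eq_mul, mul_sub,
        mul_left_comm _ τ, Finset.sum_sub_distrib, ← Finset.mul_sum, ← Finset.sum_mul, ← hs]
      simp
    rw [h1, h2]
    split_ifs
    · field_simp
    · field_simp
      ring
  have hZ1 : ∀ i, ∑ j, Z i j = q / (2 * τ * s) := by
    intro i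
    have h1 : ∑ j, Z i j = (τ * s)⁻¹ * ∑ j, ∑ k, d j * d k * f j k i := by
      simp only [Z, of_apply, Finset.mul_sum, Finset.sum_mul]
      exact Finset.sum_congr rfl fun j _ => Finset.sum_congr rfl fun k _ => by ring
    -- Symmetrizing in `j`, `k` removes the dependence on `i`, so `Z` has constant row sums, each
    -- half its trace.
    have h2 : (∑ j, ∑ k, d j * d k * f j k i) + (∑ j, ∑ k, d j * d k * f j k i) = q := by
      nth_rw 2 [Finset.sum_comm]
      simp only [hq', ← Finset.sum_add_distrib]
      refine Finset.sum_congr rfl fun j _ => Finset.sum_congr rfl fun k _ => ?_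
      rw [← hsymm j k i]
      ring
    rw [h1, ← h2]
    field_simp
    ring
  have hZtr : trace Z = q / (τ * s) := by
    simp only [trace, diag_apply, Z, of_apply, hS, hq', Finset.mul_sum, Finset.sum_mul,
      Finset.sum_div]
    refine Finset.sum_congr rfl fun j _ => Finset.sum_congr rfl fun k _ => ?_
    field_simp
  intro v hv
  set M := 1 - transitionMatrix A + vecMulVec 1 v with hM
  have hdinv : (diagonal d)⁻¹ = diagonal d⁻¹ := by
    refine inv_eq_right_inv ?_
    rw [diagonal_mul_diagonal, ← diagonal_one]
    congr 1
    ext i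
    simp [hd0]
  have hML : M = diagonal d⁻¹ * L + vecMulVec 1 v := by
    have : diagonal d⁻¹ * diagonal d = (1 : Matrix V V ℝ) := by
      rw [diagonal_mul_diagonal, ← diagonal_one]
      congr 1
      ext i
      simp [hd0]
    rw [hM, hL, transitionMatrix, ← hd, hdinv, mul_sub, this]
  -- As `M 1 = 1` and `M Z = I - 1 dᵀ / s + 1 vᵀ Z`, this `c` makes `Z + 1 cᵀ` the inverse of `M`.
  let c : V → ℝ := s⁻¹ • d - v ᵥ* Z
  have hM1 : M *ᵥ 1 = 1 := by
    rw [hML, add_mulVec, ← mulVec_mulVec, hL1, mulVec_zero, zero_add, vecMulVec_mulVec, hv]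
    simp
  have hMY : M * (Z + vecMulVec 1 c) = 1 := by
    rw [mul_add, mul_vecMulVec, hM1, hML, add_mul, Matrix.mul_assoc, vecMulVec_mul]
    ext i j
    simp only [Matrix.add_apply, diagonal_mul, hLZ, vecMulVec_apply, c, Pi.inv_apply, Pi.one_apply,
      Pi.sub_apply, Pi.smul_apply, smul_eq_mul, one_apply]
    have := hd0 i
    split_ifs with h
    · subst h
      field_simp
      ring
    · field_simp
      ring
  refine ⟨IsUnit.of_mul_eq_one _ hMY, ?_⟩
  rw [inv_eq_right_inv hMY, trace_add, hZtr, trace_vecMulVec]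
  have hc : 1 ⬝ᵥ c = 1 - q / (2 * τ * s) := by
    have h1 : (v ᵥ* Z) ⬝ᵥ 1 = q / (2 * τ * s) := by
      rw [← dotProduct_mulVec]
      have : Z *ᵥ 1 = (q / (2 * τ * s)) • 1 := by
        ext i
        simp [mulVec, dotProduct, hZ1]
      rw [this, dotProduct_smul, hv, smul_eq_mul, mul_one]
    rw [dotProduct_comm, sub_dotProduct, h1, smul_dotProduct]
    simp only [dotProduct, Pi.one_apply, mul_one, smul_eq_mul, ← hs]
    rw [inv_mul_cancel₀ hs0]
  rw [hc]
  field_simp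
  ring

/-! ### The graph with a loop -/

theorem degVec_loopAdjMatrix {V : Type*} [Fintype V] [DecidableEq V] (G : SimpleGraph V)
    [DecidableRel G.Adj] (k : V) (w : ℝ) :
    degVec (loopAdjMatrix G k w) = degreeVector G + w • Pi.single k 1 := by
  rw [degVec, loopAdjMatrix, add_mulVec]
  ext i
  have h1 : (G.adjMatrix ℝ *ᵥ 1) i = G.degree i := by
    rw [SimpleGraph.adjMatrix_mulVec_apply]
    simp
  rw [Pi.add_apply, h1]
  simp [degreeVector, mulVec, dotProduct, single_apply, Pi.single_apply, eq_comm, ite_and]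

theorem mainTheorem5 {V : Type*} [Fintype V] [DecidableEq V] (G : SimpleGraph V)
    [DecidableRel G.Adj] (hG : G.Connected) (k : V) (w : ℝ) (hw : 0 < w) :
    IsKemenyConstant (transitionMatrix (loopAdjMatrix G k w))
      ((degreeVector G ⬝ᵥ (twoForestMatrix G *ᵥ degreeVector G)
          + 2 * w * (degreeVector G ⬝ᵥ (twoForestMatrix G *ᵥ Pi.single k 1)))
        / (2 * (numSpanningTrees G : ℝ) * (2 * (G.edgeFinset.card : ℝ) + w))) := by
  have hne : Nonempty V := ⟨k⟩
  have hdeg := degVec_loopAdjMatrix G k w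
  have hpos : ∀ i, 0 < degVec (loopAdjMatrix G k w) i := by
    intro i
    have hnn : (0 : ℝ) ≤ degreeVector G i := Nat.cast_nonneg _
    rw [hdeg, Pi.add_apply, Pi.smul_apply, Pi.single_apply, smul_eq_mul]
    -- At `k` the loop gives positivity even when `G` is a single vertex; another vertex forces `G`
    -- to be nontrivial, so connectedness gives it a neighbour.
    split_ifs with h
    · linarith
    · have : Nontrivial V := ⟨⟨i, k, h⟩⟩
      have h1 : (0 : ℝ) < degreeVector G i :=
        Nat.cast_pos.mpr (hG.preconnected.degree_pos_of_nontrivial i)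
      linarith
  have hτ : (numSpanningTrees G : ℝ) ≠ 0 := by
    obtain ⟨T, hTG, hT⟩ := hG.exists_isTree_le
    rw [← SimpleGraph.card_spanningTrees, Nat.cast_ne_zero, Finset.card_ne_zero]
    exact ⟨T, SimpleGraph.mem_spanningTrees.mpr ⟨hTG, hT⟩⟩
  have hlap : diagonal (degVec (loopAdjMatrix G k w)) - loopAdjMatrix G k w = G.lapMatrix ℝ := by
    rw [hdeg, SimpleGraph.lapMatrix, SimpleGraph.degMatrix, loopAdjMatrix]
    ext i j
    by_cases h : i = j
    · subst h
      simp [degreeVector, single_apply, Pi.single_apply, eq_comm]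
    · have h' : ¬ (k = i ∧ k = j) := fun h' => h (h'.1.symm.trans h'.2)
      simp [h, h']
  have hsymm : ∀ j k i,
      G.forestPotential j k i + G.forestPotential k j i = twoForestMatrix G j k :=
    G.forestPotential_add_swap
  have key := isKemenyConstant_of_potential (S := twoForestMatrix G) (f := G.forestPotential)
    hpos hτ (fun j l => by rw [hlap, G.lapMatrix_mulVec_forestPotential])
    G.forestPotential_self_left hsymm
  have hsum : ∑ i, degVec (loopAdjMatrix G k w) i = 2 * (G.edgeFinset.card : ℝ) + w := by
    have h1 : ∑ i, degreeVector G i = 2 * (G.edgeFinset.card : ℝ) := by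
      simp only [degreeVector]
      exact_mod_cast G.sum_degrees_eq_twice_card_edges
    simp only [hdeg, Pi.add_apply, Finset.sum_add_distrib, h1]
    simp [← Finset.mul_sum]
  have htr : (twoForestMatrix G)ᵀ = twoForestMatrix G := by
    ext i j
    rw [transpose_apply, ← hsymm i j i, ← hsymm j i i, add_comm]
  have hswap : (Pi.single k 1 : V → ℝ) ⬝ᵥ (twoForestMatrix G *ᵥ degreeVector G) =
      degreeVector G ⬝ᵥ (twoForestMatrix G *ᵥ Pi.single k 1) := by
    rw [dotProduct_mulVec, ← mulVec_transpose, htr, dotProduct_comm]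
  have hdiag : (Pi.single k 1 : V → ℝ) ⬝ᵥ (twoForestMatrix G *ᵥ Pi.single k 1) = 0 := by
    simp [twoForestMatrix, SimpleGraph.numTwoForests_self]
  have hnum : degVec (loopAdjMatrix G k w) ⬝ᵥ
        (twoForestMatrix G *ᵥ degVec (loopAdjMatrix G k w)) =
      degreeVector G ⬝ᵥ (twoForestMatrix G *ᵥ degreeVector G)
        + 2 * w * (degreeVector G ⬝ᵥ (twoForestMatrix G *ᵥ Pi.single k 1)) := by
    simp only [hdeg, mulVec_add, mulVec_smul, dotProduct_add, add_dotProduct, dotProduct_smul,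
      smul_dotProduct, smul_eq_mul, hswap, hdiag]
    ring
  rwa [hsum, hnum] at key
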